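/- Let $K$ be a field containing an element of multiplicative order $4$, and let $$G=(\mathrm{C}_2\times \mathrm{C}_2)\rtimes \mathrm{C}_4=\langle a,b,c\mid a^2=b^2=c^4=1,\ ab=ba,\ cac^{-1}=b,\ cbc^{-1}=a\rangle,$$ the non-abelian semidirect product of order $16$ in which a generator of $\mathrm{C}_4$ interchanges the two factors of $\mathrm{C}_2\times\mathrm{C}_2$. Then $$\beta_{\mathrm{sep}}^K(G)=6.$$ Here, for a finite dimensional representation $V$ of $G$ over $K$ with coordinate ring $K[V]\cong K[x_1,\dots,x_n]$, $n=\dim V$, $\beta_{\mathrm{sep}}(G,V)$ is the least $d\in\{0,1,2,\dots\}$ such that any two points $v,w\in V$ with $f(v)=f(w)$ for all $G$-invariant polynomials $f\in K[V]^G$ of degree at most $d$ lie in the same $G$-orbit, and the separating Noether number $\beta_{\mathrm{sep}}^K(G)$ is the supremum of $\beta_{\mathrm{sep}}(G,V)$ over all finite dimensional representations $V$ of $G$ over $K$. -/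

import Mathlib

open MvPolynomial

noncomputable section

namespace SepNoether

/-! ### Polynomial invariants and the separating Noether number

Every finite dimensional `K G`-module is isomorphic, after a choice of basis, to a representation
of `G` on some `Kⁿ = (Fin n → K)`, and its coordinate ring is then the polynomial ring
`MvPolynomial (Fin n) K`. Invariance is an identity of formal polynomials, not of functions (the
two differ over finite fields). -/

variable {K : Type*} [Field K] {G : Type*} [Group G] {n : ℕ}

/-- The `K`-algebra endomorphism `f ↦ f ∘ T` of `K[x₁,…,xₙ]`: it replaces the variable `xᵢ` by the
linear form `∑ⱼ Tᵢⱼ xⱼ`, the `i`-th coordinate of `T x`. -/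
def linSubst (T : (Fin n → K) →ₗ[K] (Fin n → K)) :
    MvPolynomial (Fin n) K →ₐ[K] MvPolynomial (Fin n) K :=
  bind₁ fun i => ∑ j, C (LinearMap.toMatrix' T i j) * X j

theorem eval_linSubst (T : (Fin n → K) →ₗ[K] (Fin n → K)) (f : MvPolynomial (Fin n) K)
    (v : Fin n → K) : eval v (linSubst T f) = eval (T v) f := by
  have h : ∀ i, eval v (∑ j, C (LinearMap.toMatrix' T i j) * X j) = T v i := by
    intro i
    have := congrFun (LinearMap.toMatrix'_mulVec T v) i
    simpa [Matrix.mulVec, dotProduct] using this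
  rw [linSubst, ← MvPolynomial.coe_aeval_eq_eval, ← MvPolynomial.coe_aeval_eq_eval]
  simp only [RingHom.coe_coe, aeval_bind₁]
  congr 2
  funext i
  simpa [MvPolynomial.coe_aeval_eq_eval] using h i

/-- The invariants `K[V]^G`: polynomials `f` with `g · f = f` for all `g`, where
`g · f = f ∘ g⁻¹`. -/
def invariants (ρ : Representation K G (Fin n → K)) : Set (MvPolynomial (Fin n) K) :=
  {f | ∀ g : G, linSubst (ρ g⁻¹) f = f}

/-- `K[V]^G_{≤ d}`: the invariants of degree at most `d`. -/
def invariantsLE (ρ : Representation K G (Fin n → K)) (d : ℕ) : Set (MvPolynomial (Fin n) K) :=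
  {f | f ∈ invariants ρ ∧ f.totalDegree ≤ d}

/-- A set `S` of polynomials is separating if two points of `V` at which every member of `S`
takes equal values lie in the same `G`-orbit. -/
def IsSeparating (ρ : Representation K G (Fin n → K)) (S : Set (MvPolynomial (Fin n) K)) : Prop :=
  ∀ v w : Fin n → K, (∀ f ∈ S, eval v f = eval w f) → ∃ g : G, ρ g v = w

/-- `β_sep(G, V)`: the least `d` such that the invariants of degree at most `d` are separating
(`⊤` if there were no such `d`). -/
def betaSepRep (ρ : Representation K G (Fin n → K)) : ℕ∞ :=
  ⨅ (d : ℕ) (_ : IsSeparating ρ (invariantsLE ρ d)), (d : ℕ∞)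

variable (K G) in
/-- `β_sep^K(G)`: the supremum of `β_sep(G, V)` over all finite dimensional `K G`-modules `V`. -/
def betaSep : ℕ∞ :=
  ⨆ (n : ℕ) (ρ : Representation K G (Fin n → K)), betaSepRep ρ

/-! ### The group `(C₂ × C₂) ⋊ C₄` -/

/-- The cyclic group of order `m`, written multiplicatively. -/
abbrev Cyc (m : ℕ) : Type := Multiplicative (ZMod m)

/-- The automorphism of `C₂ × C₂` that interchanges the two factors. -/
def swapAut : MulAut (Cyc 2 × Cyc 2) := MulEquiv.prodComm

theorem swapAut_sq : swapAut ^ 2 = 1 := by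
  ext x <;> rfl

/-- The action of `C₄` on `C₂ × C₂` in which the generator interchanges the two factors. -/
def swapAction : Cyc 4 →* MulAut (Cyc 2 × Cyc 2) where
  toFun k := swapAut ^ (Multiplicative.toAdd k).val
  map_one' := by simp
  map_mul' x y := by
    have h4 : swapAut ^ 4 = 1 := by
      rw [show 4 = 2 * 2 from rfl, pow_mul, swapAut_sq, one_pow]
    rw [← pow_add, toAdd_mul, ZMod.val_add, ← pow_eq_pow_mod _ h4]

/-- The group `(C₂ × C₂) ⋊ C₄` of order 16. -/
abbrev C2C2C4 : Type := (Cyc 2 × Cyc 2) ⋊[swapAction] Cyc 4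

/-- The relators of `⟨a, b, c ∣ a² = b² = c⁴ = 1, ab = ba, cac⁻¹ = b, cbc⁻¹ = a⟩`, with
`a, b, c` the free generators `0, 1, 2`. -/
def presRels : Set (FreeGroup (Fin 3)) :=
  let a := FreeGroup.of (0 : Fin 3)
  let b := FreeGroup.of (1 : Fin 3)
  let c := FreeGroup.of (2 : Fin 3)
  {a ^ 2, b ^ 2, c ^ 4, a * b * (b * a)⁻¹, c * a * c⁻¹ * b⁻¹, c * b * c⁻¹ * a⁻¹}

/-- The elements `a`, `b`, `c` of `(C₂ × C₂) ⋊ C₄`. -/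
def gens : Fin 3 → C2C2C4 :=
  ![⟨(.ofAdd 1, 1), 1⟩, ⟨(1, .ofAdd 1), 1⟩, ⟨1, .ofAdd 1⟩]

theorem lift_gens_eq_one : ∀ r ∈ presRels, FreeGroup.lift gens r = 1 := by
  intro r hr
  simp only [presRels, Set.mem_insert_iff, Set.mem_singleton_iff] at hr
  rcases hr with rfl | rfl | rfl | rfl | rfl | rfl <;>
    simp only [map_mul, map_pow, map_inv, FreeGroup.lift_apply_of, gens] <;> rfl

/-- The semidirect product is the group with the above presentation. -/
theorem bijective_toGroup :
    Function.Bijective (PresentedGroup.toGroup (f := gens) lift_gens_eq_one) := by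
  set P := PresentedGroup presRels
  have rel : ∀ r ∈ presRels, PresentedGroup.mk presRels r = 1 := fun r hr =>
    PresentedGroup.one_of_mem hr
  let a : P := PresentedGroup.of 0
  let b : P := PresentedGroup.of 1
  let c : P := PresentedGroup.of 2
  have ha : a ^ 2 = 1 := rel (FreeGroup.of 0 ^ 2) (by simp [presRels])
  have hb : b ^ 2 = 1 := rel (FreeGroup.of 1 ^ 2) (by simp [presRels])
  have hc : c ^ 4 = 1 := rel (FreeGroup.of 2 ^ 4) (by simp [presRels])
  have hab : a * b = b * a := mul_inv_eq_one.1
    (rel (FreeGroup.of 0 * FreeGroup.of 1 * (FreeGroup.of 1 * FreeGroup.of 0)⁻¹)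
      (by simp [presRels]))
  have hca : c * a * c⁻¹ = b := mul_inv_eq_one.1
    (rel (FreeGroup.of 2 * FreeGroup.of 0 * (FreeGroup.of 2)⁻¹ * (FreeGroup.of 1)⁻¹)
      (by simp [presRels]))
  have hcb : c * b * c⁻¹ = a := mul_inv_eq_one.1
    (rel (FreeGroup.of 2 * FreeGroup.of 1 * (FreeGroup.of 2)⁻¹ * (FreeGroup.of 0)⁻¹)
      (by simp [presRels]))
  let F := PresentedGroup.toGroup (f := gens) lift_gens_eq_one
  let s : C2C2C4 → P := fun x => a ^ (Multiplicative.toAdd x.left.1).val *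
    b ^ (Multiplicative.toAdd x.left.2).val * c ^ (Multiplicative.toAdd x.right).val
  have key : ∀ i x, s (gens i * x) = PresentedGroup.of i * s x := by
    rintro i ⟨⟨p, q⟩, r⟩
    have hp : a ^ (1 + (Multiplicative.toAdd p).val) =
        a ^ ((1 + (Multiplicative.toAdd p).val) % 2) := pow_eq_pow_mod _ ha
    have hq : b ^ (1 + (Multiplicative.toAdd q).val) =
        b ^ ((1 + (Multiplicative.toAdd q).val) % 2) := pow_eq_pow_mod _ hb
    have hr : c ^ (1 + (Multiplicative.toAdd r).val) =
        c ^ ((1 + (Multiplicative.toAdd r).val) % 4) := pow_eq_pow_mod _ hc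
    have hcomm : Commute a b := hab
    have h1 : ∀ k : ℕ, c * a ^ k = b ^ k * c := fun k => by
      rw [← hca, conj_pow]; group
    have h2 : ∀ k : ℕ, c * b ^ k = a ^ k * c := fun k => by
      rw [← hcb, conj_pow]; group
    fin_cases i
    · change a ^ ((1 + (Multiplicative.toAdd p).val) % 2) *
        b ^ ((0 + (Multiplicative.toAdd q)).val) * c ^ ((0 + (Multiplicative.toAdd r)).val) = a * _
      rw [← hp, zero_add, zero_add, pow_add, pow_one]
      simp only [s, mul_assoc]
    · change a ^ ((0 + (Multiplicative.toAdd p)).val) *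
        b ^ ((1 + (Multiplicative.toAdd q).val) % 2) * c ^ ((0 + (Multiplicative.toAdd r)).val)
          = b * _
      rw [← hq, zero_add, zero_add, pow_add, pow_one]
      simp only [s, ← mul_assoc]
      rw [((hcomm.symm).pow_right _).eq]
    · change a ^ ((0 + (Multiplicative.toAdd q)).val) *
        b ^ ((0 + (Multiplicative.toAdd p)).val) * c ^ ((1 + (Multiplicative.toAdd r).val) % 4)
          = c * _
      rw [← hr, zero_add, zero_add, pow_add, pow_one]
      simp only [s, ← mul_assoc]
      rw [h1, mul_assoc _ c (b ^ _), h2]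
      simp only [← mul_assoc]
      rw [(hcomm.pow_pow _ _).eq]
  have hs1 : s 1 = 1 := by
    change a ^ 0 * b ^ 0 * c ^ 0 = 1
    simp
  have hsF : ∀ x : P, s (F x) = x := by
    have hmul : ∀ (x : P) y, s (F x * y) = x * s y := by
      intro x
      have hx : x ∈ Subgroup.closure (Set.range (PresentedGroup.of (rels := presRels))) := by
        rw [PresentedGroup.closure_range_of]; trivial
      induction hx using Subgroup.closure_induction with
      | mem x hx =>
        obtain ⟨i, rfl⟩ := hx
        intro y
        rw [← key, PresentedGroup.toGroup.of]
      | one => intro y; rw [map_one, one_mul, one_mul]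
      | mul x y _ _ h1 h2 => intro z; rw [map_mul, mul_assoc, h1, h2, mul_assoc]
      | inv x _ h =>
        intro y
        rw [eq_inv_mul_iff_mul_eq, ← h, ← mul_assoc, ← map_mul, mul_inv_cancel, map_one, one_mul]
    intro x
    have := hmul x 1
    rwa [mul_one, hs1, mul_one] at this
  refine ⟨Function.LeftInverse.injective hsF, fun x => ⟨s x, ?_⟩⟩
  have h0 : F a = gens 0 := PresentedGroup.toGroup.of _
  have h1 : F b = gens 1 := PresentedGroup.toGroup.of _
  have h2 : F c = gens 2 := PresentedGroup.toGroup.of _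
  change F (s x) = x
  simp only [s, map_mul, map_pow, h0, h1, h2]
  have : ∀ (p q : ZMod 2) (r : ZMod 4), gens 0 ^ p.val * gens 1 ^ q.val * gens 2 ^ r.val =
      ⟨(.ofAdd p, .ofAdd q), .ofAdd r⟩ := by
    intro p q r
    fin_cases p <;> fin_cases q <;> fin_cases r <;> rfl
  exact this _ _ _

end SepNoether

end

/-!
The group `G = (C₂ × C₂) ⋊ C₄` has the elementary abelian subgroup `A = ⟨a, b, c²⟩` of order eight
and index two, and the characteristic of `K` is not two.

*Upper bound.* Let all invariants of degree at most six agree at `v` and `w`. For an invariant `f` of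
`A` of degree at most three, the trace `f + c f` and the norm `f · c f` are invariants of `G` of degree
at most six, so `{f(v), f(c v)} = {f(w), f(c w)}`; after replacing `w` by `c w`, all such `f` agree at
`v` and `w` (`agree_or_agree`). Split the dual space into weight spaces of `A`, with weights in
`𝔽₂³`. The products of two forms of equal weight show that on each weight space `w` is `v` up to a sign
`(-1)^e(p)`. The products of three forms show that `e` is additive on relations with three terms among
the weights in the support of `v`. If `e` is linear on the support, then `w` is in the `A`-orbit of
`v`. Otherwise the support, apart from zero, consists of the four weights outside a plane
(`exists_pairing_eq`), and the product `f` of four forms of these weights has `f(w) = -f(v) ≠ 0`. For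
every invariant `k` of `A` of degree at most two, `f k` has degree at most six, and equality of the
traces of `f k` at `v` and `w` forces `k(v) = k(c v)` and `f(c v) = -f(v)`. So `c v` too is `v` up to
signs on the weight spaces, and the signs comparing `w` with `c v` now multiply to `1` on the four
weights; hence `w` is in the `A`-orbit of `c v` (`exists_apply_eq_of_agree`).

*Lower bound.* Let `i² = -1` in `K`. On `K⁴` with coordinates `(y, y', q, r)`, let `a` and `b` change
the signs of `(y', r)` and `(y, r)`, and let `c` interchange `y` and `y'` and multiply `q` and `r` by
`i`. The monomials of an invariant have exponents of equal parity, and `y y' q r` does not occur since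
`c` changes its sign. So all invariants of degree at most five agree at `(1, 1, 1, 1)` and
`(-1, 1, 1, 1)` (`eval_eq_of_totalDegree_le_five`), while the invariant `y y' q³ r` of degree six
separates these points (`fourDimRep_sextic`).
-/

open MvPolynomial

noncomputable section

namespace SepNoether

/-! ### Linear algebra in the cube over the field with two elements -/

/-- The elementary abelian group `C₂³`, written additively; it is identified with its character
group by `pairing`. -/
abbrev F2Cube : Type := ZMod 2 × ZMod 2 × ZMod 2

/-- The standard bilinear form on `𝔽₂³`. -/
def pairing (p x : F2Cube) : ZMod 2 := p.1 * x.1 + p.2.1 * x.2.1 + p.2.2 * x.2.2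

theorem pairing_zero_left (x : F2Cube) : pairing 0 x = 0 := by simp [pairing]

theorem pairing_add_left (p q x : F2Cube) : pairing (p + q) x = pairing p x + pairing q x := by
  simp only [pairing, Prod.fst_add, Prod.snd_add]; ring

theorem pairing_add_right (p x y : F2Cube) : pairing p (x + y) = pairing p x + pairing p y := by
  simp only [pairing, Prod.fst_add, Prod.snd_add]; ring

theorem add_self_eq_zero_of_cube (p : F2Cube) : p + p = 0 := by revert p; decide

/-- Linear independence of two vectors of `𝔽₂³`, spelled out so that it is decidable. -/
abbrev IsIndepPair (p q : F2Cube) : Prop := p ≠ 0 ∧ q ≠ 0 ∧ q ≠ p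

/-- Linear independence of three vectors of `𝔽₂³`, spelled out so that it is decidable. -/
abbrev IsIndepTriple (p q r : F2Cube) : Prop :=
  IsIndepPair p q ∧ r ≠ 0 ∧ r ≠ p ∧ r ≠ q ∧ r ≠ p + q

set_option synthInstance.maxSize 1000 in
theorem exists_pairing_eq_triple : ∀ p q r : F2Cube, IsIndepTriple p q r →
    ∀ a b c, ∃ x, pairing p x = a ∧ pairing q x = b ∧ pairing r x = c := by
  decide +kernel

set_option synthInstance.maxSize 1000 in
theorem mem_span_triple : ∀ p q r : F2Cube, IsIndepTriple p q r → ∀ t,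
    t = 0 ∨ t = p ∨ t = q ∨ t = r ∨ t = p + q ∨ t = p + r ∨ t = q + r ∨ t = p + q + r := by
  decide +kernel

set_option synthInstance.maxSize 1000 in
theorem notMem_of_isIndepTriple : ∀ p q r : F2Cube, IsIndepTriple p q r →
    p ∉ ({q, r, p + q + r} : Finset F2Cube) ∧ q ∉ ({r, p + q + r} : Finset F2Cube) ∧
      r ∉ ({p + q + r} : Finset F2Cube) := by
  decide +kernel

theorem exists_pairing_eq_pair : ∀ p q : F2Cube, IsIndepPair p q →
    ∀ a b, ∃ x, pairing p x = a ∧ pairing q x = b := by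
  decide +kernel

theorem exists_pairing_eq_single : ∀ p : F2Cube, p ≠ 0 → ∀ a, ∃ x, pairing p x = a := by
  decide +kernel

/-- A function `e` on a subset `S` of `𝔽₂³` extends to a linear form as soon as it respects the
linear relations with at most three terms inside `S`, and the relation with four terms in the case
where the nonzero part of `S` is exactly the complement of a plane. Indeed the other relations with
four terms inside `S` split into two relations with three terms. -/
theorem exists_pairing_eq (S : F2Cube → Prop) (e : F2Cube → ZMod 2)
    (hline : ∀ p q, S p → S q → S (p + q) → e (p + q) = e p + e q)
    (hcirc : ∀ g, (∀ p, p ≠ 0 → (S p ↔ pairing p g = 1)) →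
      ∑ p with pairing p g = 1, e p = 0) :
    ∃ x, ∀ p, S p → pairing p x = e p := by
  have h0 : S 0 → e 0 = 0 := fun h => by simpa using hline 0 0 h h (by simpa using h)
  by_cases h3 : ∃ p q r, S p ∧ S q ∧ S r ∧ IsIndepTriple p q r
  · obtain ⟨p, q, r, hp, hq, hr, hind⟩ := h3
    have hspan := mem_span_triple p q r hind
    obtain ⟨x, hxp, hxq, hxr⟩ := exists_pairing_eq_triple p q r hind (e p) (e q) (e r)
    have htriple : S (p + q + r) → e (p + q + r) = e p + e q + e r := by
      intro ht
      by_cases hpq : S (p + q)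
      · rw [hline _ _ hpq hr ht, hline _ _ hp hq hpq]
      by_cases hpr : S (p + r)
      · rw [add_right_comm] at ht ⊢
        rw [hline _ _ hpr hq ht, hline _ _ hp hr hpr, add_right_comm]
      by_cases hqr : S (q + r)
      · rw [add_assoc] at ht ⊢
        rw [hline _ _ hp hqr ht, hline _ _ hq hr hqr, add_assoc]
      -- The only relation left is the one with four terms, and then `S` is a plane complement.
      obtain ⟨g, hgp, hgq, hgr⟩ := exists_pairing_eq_triple p q r hind 1 1 1
      have h2 : (1 : ZMod 2) + 1 ≠ 1 := by decide
      have h3 : (1 : ZMod 2) + 1 + 1 = 1 := by decide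
      have hgpq : pairing (p + q) g ≠ 1 := by rwa [pairing_add_left, hgp, hgq]
      have hgpr : pairing (p + r) g ≠ 1 := by rwa [pairing_add_left, hgp, hgr]
      have hgqr : pairing (q + r) g ≠ 1 := by rwa [pairing_add_left, hgq, hgr]
      have hgt : pairing (p + q + r) g = 1 := by
        rwa [pairing_add_left, pairing_add_left, hgp, hgq, hgr]
      have hs := hcirc g fun t ht0 => by
        rcases hspan t with rfl | rfl | rfl | rfl | rfl | rfl | rfl | rfl
        · exact absurd rfl ht0
        · exact iff_of_true hp hgp
        · exact iff_of_true hq hgq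
        · exact iff_of_true hr hgr
        · exact iff_of_false hpq hgpq
        · exact iff_of_false hpr hgpr
        · exact iff_of_false hqr hgqr
        · exact iff_of_true ht hgt
      have hfil : ({t | pairing t g = 1} : Finset F2Cube) = {p, q, r, p + q + r} := by
        ext t
        simp only [Finset.mem_filter, Finset.mem_univ, true_and, Finset.mem_insert,
          Finset.mem_singleton]
        constructor
        · intro ht
          rcases hspan t with h | h | h | h | h | h | h | h
          · rw [h, pairing_zero_left] at ht
            exact absurd ht zero_ne_one
          · exact .inl h
          · exact .inr (.inl h)
          · exact .inr (.inr (.inl h))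
          · exact absurd (h ▸ ht) hgpq
          · exact absurd (h ▸ ht) hgpr
          · exact absurd (h ▸ ht) hgqr
          · exact .inr (.inr (.inr h))
        · rintro (rfl | rfl | rfl | rfl) <;> assumption
      obtain ⟨hpn, hqn, hrn⟩ := notMem_of_isIndepTriple p q r hind
      rw [hfil, Finset.sum_insert hpn, Finset.sum_insert hqn, Finset.sum_insert hrn,
        Finset.sum_singleton] at hs
      have : e (p + q + r) = -(e p + e q + e r) := by linear_combination hs
      rw [this, ZMod.neg_eq_self_mod_two]
    refine ⟨x, fun t ht => ?_⟩
    rcases hspan t with rfl | rfl | rfl | rfl | rfl | rfl | rfl | rfl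
    · rw [pairing_zero_left, h0 ht]
    · exact hxp
    · exact hxq
    · exact hxr
    · rw [pairing_add_left, hline _ _ hp hq ht, hxp, hxq]
    · rw [pairing_add_left, hline _ _ hp hr ht, hxp, hxr]
    · rw [pairing_add_left, hline _ _ hq hr ht, hxq, hxr]
    · rw [pairing_add_left, pairing_add_left, htriple ht, hxp, hxq, hxr]
  by_cases h2 : ∃ p q, S p ∧ S q ∧ IsIndepPair p q
  · obtain ⟨p, q, hp, hq, hind⟩ := h2
    obtain ⟨x, hxp, hxq⟩ := exists_pairing_eq_pair p q hind (e p) (e q)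
    refine ⟨x, fun t ht => ?_⟩
    by_contra hne
    refine h3 ⟨p, q, t, hp, hq, ht, hind, ?_, ?_, ?_, ?_⟩ <;> rintro rfl <;> apply hne
    · rw [pairing_zero_left, h0 ht]
    · exact hxp
    · exact hxq
    · rw [pairing_add_left, hline _ _ hp hq ht, hxp, hxq]
  by_cases h1 : ∃ p, S p ∧ p ≠ 0
  · obtain ⟨p, hp, hp0⟩ := h1
    obtain ⟨x, hxp⟩ := exists_pairing_eq_single p hp0 (e p)
    refine ⟨x, fun t ht => ?_⟩
    by_contra hne
    refine h2 ⟨p, t, hp, ht, hp0, ?_, ?_⟩ <;> rintro rfl <;> apply hne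
    · rw [pairing_zero_left, h0 ht]
    · exact hxp
  · refine ⟨0, fun t ht => ?_⟩
    obtain rfl : t = 0 := by_contra fun h => h1 ⟨t, ht, h⟩
    rw [pairing_zero_left, h0 ht]

/-- The sign `(-1)ᵃ` in `K` of a parity `a`. -/
def sgn (K : Type*) [Field K] (a : ZMod 2) : K := if a = 0 then 1 else -1

section sgn
variable {K : Type*} [Field K]

theorem sgn_zero : sgn K 0 = 1 := if_pos rfl

theorem sgn_one : sgn K 1 = -1 := if_neg one_ne_zero

theorem sgn_add (a b : ZMod 2) : sgn K (a + b) = sgn K a * sgn K b := by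
  have h2 : ∀ a : ZMod 2, a = 0 ∨ a = 1 := by decide
  have h : (1 : ZMod 2) + 1 = 0 := by decide
  rcases h2 a with rfl | rfl <;> rcases h2 b with rfl | rfl <;> simp [sgn_zero, sgn_one, h]

theorem sgn_mul_self (a : ZMod 2) : sgn K a * sgn K a = 1 := by
  rw [← sgn_add, CharTwo.add_self_eq_zero, sgn_zero]

theorem sgn_sum {ι : Type*} (s : Finset ι) (a : ι → ZMod 2) :
    sgn K (∑ i ∈ s, a i) = ∏ i ∈ s, sgn K (a i) := by
  classical
  induction s using Finset.induction_on with
  | empty => simp [sgn_zero]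
  | insert i s hi ih => rw [Finset.sum_insert hi, Finset.prod_insert hi, sgn_add, ih]

theorem eq_zero_of_sgn_eq_one (h2 : (2 : K) ≠ 0) {a : ZMod 2} (h : sgn K a = 1) : a = 0 := by
  by_contra ha
  rw [sgn, if_neg ha] at h
  exact h2 (by linear_combination -h)

theorem sum_sgn_pairing (x : F2Cube) :
    ∑ p, sgn K (pairing p x) = if x = 0 then 8 else 0 := by
  have h : ∀ x, (∑ p, if pairing p x = 0 then (1 : ℤ) else -1) = if x = 0 then 8 else 0 := by
    decide +kernel
  have := congrArg (Int.cast : ℤ → K) (h x)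
  push_cast at this
  exact this

end sgn

/-! ### Substitution of linear maps into polynomials -/

variable {K : Type*} [Field K] {G : Type*} [Group G] {n : ℕ}

theorem linSubst_X (T : (Fin n → K) →ₗ[K] (Fin n → K)) (i : Fin n) :
    linSubst T (X i) = ∑ j, C (LinearMap.toMatrix' T i j) * X j := by
  simp [linSubst]

/-- `f ↦ f ∘ T` reverses the order of composition. -/
theorem linSubst_mul (S T : (Fin n → K) →ₗ[K] (Fin n → K)) (f : MvPolynomial (Fin n) K) :
    linSubst (S * T) f = linSubst T (linSubst S f) := by
  have : linSubst (S * T) = (linSubst T).comp (linSubst S) := by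
    refine MvPolynomial.algHom_ext fun i => ?_
    rw [AlgHom.comp_apply, linSubst_X, linSubst_X, map_sum]
    simp only [map_mul, linSubst_X, LinearMap.toMatrix'_mul, Matrix.mul_apply, map_sum,
      Finset.sum_mul, Finset.mul_sum]
    rw [Finset.sum_comm]
    refine Finset.sum_congr rfl fun k _ => Finset.sum_congr rfl fun j _ => ?_
    rw [← algebraMap_eq, AlgHom.commutes, mul_assoc]
  rw [this, AlgHom.comp_apply]

theorem totalDegree_linSubst_le (T : (Fin n → K) →ₗ[K] (Fin n → K)) (f : MvPolynomial (Fin n) K) :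
    (linSubst T f).totalDegree ≤ f.totalDegree := by
  have hX : ∀ i, (linSubst T (X i)).totalDegree ≤ 1 := fun i => by
    rw [linSubst_X]
    exact totalDegree_finsetSum_le fun j _ => (totalDegree_mul _ _).trans (by
      rw [totalDegree_C, totalDegree_X])
  conv_lhs => rw [f.as_sum, map_sum]
  refine totalDegree_finsetSum_le fun m hm => ?_
  refine le_trans ?_ (le_totalDegree hm)
  rw [monomial_eq, map_mul, Finsupp.prod, map_prod, ← algebraMap_eq, AlgHom.commutes]
  refine (totalDegree_mul _ _).trans ?_
  rw [algebraMap_eq, totalDegree_C, zero_add]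
  refine (totalDegree_finsetProd _ _).trans (Finset.sum_le_sum fun i _ => ?_)
  rw [map_pow]
  exact (totalDegree_pow _ _).trans (by simpa using Nat.mul_le_mul_left (m i) (hX i))

/-- A linear form on `Kⁿ`, as a polynomial. -/
def linForm (l : Module.Dual K (Fin n → K)) : MvPolynomial (Fin n) K :=
  ∑ j, C (l (Pi.single j 1)) * X j

theorem dual_apply_eq_sum (l : Module.Dual K (Fin n → K)) (v : Fin n → K) :
    l v = ∑ j, l (Pi.single j 1) * v j := by
  conv_lhs => rw [pi_eq_sum_univ' v, map_sum]
  refine Finset.sum_congr rfl fun j _ => ?_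
  rw [map_smul, smul_eq_mul, mul_comm]

theorem eval_linForm (l : Module.Dual K (Fin n → K)) (v : Fin n → K) :
    eval v (linForm l) = l v := by
  rw [dual_apply_eq_sum, linForm, map_sum]
  simp

theorem linSubst_linForm (T : (Fin n → K) →ₗ[K] (Fin n → K)) (l : Module.Dual K (Fin n → K)) :
    linSubst T (linForm l) = linForm (l ∘ₗ T) := by
  simp only [linForm, map_sum, map_mul, linSubst_X, Finset.mul_sum, LinearMap.comp_apply]
  rw [Finset.sum_comm]
  refine Finset.sum_congr rfl fun j _ => ?_
  rw [dual_apply_eq_sum l (T _), map_sum, Finset.sum_mul]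
  refine Finset.sum_congr rfl fun i _ => ?_
  rw [← algebraMap_eq, AlgHom.commutes, map_mul, LinearMap.toMatrix'_apply, mul_assoc]

theorem totalDegree_linForm_le (l : Module.Dual K (Fin n → K)) :
    (linForm l).totalDegree ≤ 1 :=
  totalDegree_finsetSum_le fun j _ => (totalDegree_mul _ _).trans (by
    rw [totalDegree_C, totalDegree_X])

/-! ### Invariants of bounded degree -/

theorem invariantsLE_mono (ρ : Representation K G (Fin n → K)) {d d' : ℕ} (h : d ≤ d') :
    invariantsLE ρ d ⊆ invariantsLE ρ d' := fun _ hf => ⟨hf.1, hf.2.trans h⟩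

theorem add_mem_invariantsLE {ρ : Representation K G (Fin n → K)} {d : ℕ}
    {f h : MvPolynomial (Fin n) K} (hf : f ∈ invariantsLE ρ d) (hh : h ∈ invariantsLE ρ d) :
    f + h ∈ invariantsLE ρ d :=
  ⟨fun g => by rw [map_add, hf.1 g, hh.1 g],
    (totalDegree_add _ _).trans (max_le hf.2 hh.2)⟩

theorem mul_mem_invariantsLE {ρ : Representation K G (Fin n → K)} {d d' : ℕ}
    {f h : MvPolynomial (Fin n) K} (hf : f ∈ invariantsLE ρ d) (hh : h ∈ invariantsLE ρ d') :
    f * h ∈ invariantsLE ρ (d + d') :=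
  ⟨fun g => by rw [map_mul, hf.1 g, hh.1 g],
    (totalDegree_mul _ _).trans (add_le_add hf.2 hh.2)⟩

theorem one_mem_invariantsLE (ρ : Representation K G (Fin n → K)) (d : ℕ) :
    1 ∈ invariantsLE ρ d :=
  ⟨fun g => map_one _, by simp⟩

theorem eval_apply_of_mem_invariants {ρ : Representation K G (Fin n → K)}
    {f : MvPolynomial (Fin n) K} (hf : f ∈ invariants ρ) (g : G) (v : Fin n → K) :
    eval (ρ g v) f = eval v f := by
  have := hf g⁻¹
  rw [inv_inv] at this
  rw [← eval_linSubst, this]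

/-! ### Representations of an elementary abelian group of order eight -/

/-- The linear forms on which the group `C₂³` acts through the character with index `p`. -/
def weightForms (τ : Representation K (Multiplicative F2Cube) (Fin n → K)) (p : F2Cube) :
    Set (Module.Dual K (Fin n → K)) :=
  {l | ∀ x, l ∘ₗ τ (.ofAdd x) = sgn K (pairing p x) • l}

section weights

variable {τ : Representation K (Multiplicative F2Cube) (Fin n → K)}

theorem apply_of_mem_weightForms {p : F2Cube} {l : Module.Dual K (Fin n → K)}
    (hl : l ∈ weightForms τ p) (x : F2Cube) (v : Fin n → K) :
    l (τ (.ofAdd x) v) = sgn K (pairing p x) * l v :=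
  LinearMap.congr_fun (hl x) v

/-- The weight forms span the dual space, so they distinguish points. -/
theorem eq_of_weightForms (h2 : (2 : K) ≠ 0) {v w : Fin n → K}
    (h : ∀ p, ∀ l ∈ weightForms τ p, l v = l w) : v = w := by
  have h8 : (8 : K) ≠ 0 := by
    rw [show (8 : K) = 2 ^ 3 by norm_num]
    exact pow_ne_zero _ h2
  ext i
  let l : Module.Dual K (Fin n → K) := LinearMap.proj i
  let lp : F2Cube → Module.Dual K (Fin n → K) := fun p =>
    ∑ x, sgn K (pairing p x) • l ∘ₗ τ (.ofAdd x)
  have hmem : ∀ p, lp p ∈ weightForms τ p := by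
    intro p y
    refine LinearMap.ext fun u => ?_
    simp only [lp, LinearMap.comp_apply, LinearMap.sum_apply, LinearMap.smul_apply, smul_eq_mul,
      Finset.mul_sum]
    refine Fintype.sum_equiv (Equiv.addRight y) _ _ fun x => ?_
    rw [Equiv.coe_addRight, pairing_add_right, sgn_add, ofAdd_add, map_mul, Module.End.mul_apply]
    linear_combination (-sgn K (pairing p x) * l (τ (.ofAdd x) (τ (.ofAdd y) u))) *
      sgn_mul_self (K := K) (pairing p y)
  have hsum : ∀ u, ∑ p, lp p u = 8 * l u := by
    intro u
    simp only [lp, LinearMap.sum_apply, LinearMap.smul_apply, smul_eq_mul]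
    rw [Finset.sum_comm]
    simp only [← Finset.sum_mul, sum_sgn_pairing, ite_mul, zero_mul]
    rw [Finset.sum_ite_eq' Finset.univ 0, if_pos (Finset.mem_univ _), ofAdd_zero, map_one]
    rfl
  have := Finset.sum_congr rfl fun p (_ : p ∈ Finset.univ) => h p (lp p) (hmem p)
  rw [hsum, hsum] at this
  exact mul_left_cancel₀ h8 this

/-- A product of weight forms whose weights add up to zero is invariant. -/
theorem prod_linForm_mem {ι : Type*} (s : Finset ι) (p : ι → F2Cube)
    (l : ι → Module.Dual K (Fin n → K)) (hl : ∀ i ∈ s, l i ∈ weightForms τ (p i))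
    (hs : ∑ i ∈ s, p i = 0) : ∏ i ∈ s, linForm (l i) ∈ invariantsLE τ s.card := by
  refine ⟨fun g => ?_, ?_⟩
  · have hpair : ∀ x, ∑ i ∈ s, pairing (p i) x = pairing (∑ i ∈ s, p i) x := fun x =>
      (map_sum (⟨⟨fun q => pairing q x, pairing_zero_left x⟩,
        fun q r => pairing_add_left q r x⟩ : F2Cube →+ ZMod 2) p s).symm
    have hC : ∀ i ∈ s, linSubst (τ g⁻¹) (linForm (l i)) =
        C (sgn K (pairing (p i) (g⁻¹).toAdd)) * linForm (l i) := fun i hi => by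
      have := hl i hi (g⁻¹).toAdd
      rw [ofAdd_toAdd] at this
      rw [linSubst_linForm, this]
      simp [linForm, Finset.mul_sum, mul_assoc]
    rw [map_prod, Finset.prod_congr rfl hC, Finset.prod_mul_distrib, ← map_prod, ← sgn_sum, hpair,
      hs, pairing_zero_left, sgn_zero, map_one, one_mul]
  · refine (totalDegree_finsetProd _ _).trans ?_
    simpa using Finset.sum_le_card_nsmul s _ 1 fun i _ => totalDegree_linForm_le (l i)

/-- If the invariants of degree at most two of `C₂³` agree at `v` and `w`, then on each weight space
`w` is `v` up to a sign. -/
theorem exists_sgn_of_agree {v w : Fin n → K}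
    (h : ∀ f ∈ invariantsLE τ 2, eval v f = eval w f) :
    ∃ e : F2Cube → ZMod 2, ∀ p, ∀ l ∈ weightForms τ p, l w = sgn K (e p) * l v := by
  have hmul : ∀ p, ∀ l ∈ weightForms τ p, ∀ l' ∈ weightForms τ p, l v * l' v = l w * l' w := by
    intro p l hl l' hl'
    have := h _ (prod_linForm_mem Finset.univ ![p, p] ![l, l']
      (fun i _ => by fin_cases i <;> assumption) (by simpa using add_self_eq_zero_of_cube p))
    simpa [Fin.prod_univ_two, eval_linForm] using this
  suffices ∀ p, ∃ a : ZMod 2, ∀ l ∈ weightForms τ p, l w = sgn K a * l v by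
    choose e he using this
    exact ⟨e, he⟩
  intro p
  by_cases hp : ∃ l ∈ weightForms τ p, l v ≠ 0
  · obtain ⟨l₀, hl₀, hne⟩ := hp
    have : ∃ a : ZMod 2, l₀ w = sgn K a * l₀ v := by
      rcases mul_self_eq_mul_self_iff.1 (hmul p l₀ hl₀ l₀ hl₀) with h | h
      · exact ⟨0, by rw [sgn_zero, one_mul, h]⟩
      · exact ⟨1, by rw [sgn_one, h]; ring⟩
    obtain ⟨a, ha⟩ := this
    refine ⟨a, fun l hl => ?_⟩
    have h1 := hmul p l₀ hl₀ l hl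
    rw [ha] at h1
    refine mul_left_cancel₀ hne ?_
    linear_combination -sgn K a * h1 - l₀ v * l w * sgn_mul_self (K := K) a
  · push Not at hp
    refine ⟨0, fun l hl => ?_⟩
    have := hmul p l hl l hl
    rw [hp l hl, mul_zero, eq_comm, mul_self_eq_zero] at this
    rw [this, hp l hl, mul_zero]

/-- If on each weight space `w` is `v` up to the sign `(-1)ᵉ`, where `e` is linear on the support
of `v`, then `w` lies in the orbit of `v`. -/
theorem apply_eq_of_sgn (h2 : (2 : K) ≠ 0) {v w : Fin n → K} {e : F2Cube → ZMod 2} {x : F2Cube}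
    (he : ∀ p, ∀ l ∈ weightForms τ p, l w = sgn K (e p) * l v)
    (hx : ∀ p, (∃ l ∈ weightForms τ p, l v ≠ 0) → pairing p x = e p) :
    τ (.ofAdd x) v = w := by
  refine eq_of_weightForms (τ := τ) h2 fun p l hl => ?_
  rw [apply_of_mem_weightForms hl, he p l hl]
  by_cases hv : l v = 0
  · rw [hv, mul_zero, mul_zero]
  · rw [hx p ⟨l, hl, hv⟩]

/-- If the invariants of degree at most three agree, the signs relating `w` to `v` are compatible
with the linear relations with three terms in the support of `v`. -/
theorem sgn_line_of_agree (h2 : (2 : K) ≠ 0) {v w : Fin n → K} {e : F2Cube → ZMod 2}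
    (h : ∀ f ∈ invariantsLE τ 3, eval v f = eval w f)
    (he : ∀ p, ∀ l ∈ weightForms τ p, l w = sgn K (e p) * l v) {p q : F2Cube}
    (hp : ∃ l ∈ weightForms τ p, l v ≠ 0) (hq : ∃ l ∈ weightForms τ q, l v ≠ 0)
    (hpq : ∃ l ∈ weightForms τ (p + q), l v ≠ 0) : e (p + q) = e p + e q := by
  obtain ⟨l, hl, hlv⟩ := hp
  obtain ⟨l', hl', hlv'⟩ := hq
  obtain ⟨l'', hl'', hlv''⟩ := hpq
  have := h _ (prod_linForm_mem Finset.univ ![p, q, p + q] ![l, l', l'']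
    (fun i _ => by fin_cases i <;> assumption)
    (by simpa [Fin.sum_univ_three] using add_self_eq_zero_of_cube (p + q)))
  simp only [Fin.prod_univ_three, map_mul, eval_linForm, Matrix.cons_val] at this
  rw [he p l hl, he q l' hl', he _ l'' hl''] at this
  have h1 : sgn K (e p + e q + e (p + q)) = 1 := by
    rw [sgn_add, sgn_add]
    refine mul_right_cancel₀ (mul_ne_zero (mul_ne_zero hlv hlv') hlv'') ?_
    linear_combination -this
  have h3 := eq_zero_of_sgn_eq_one h2 h1
  rw [← CharTwo.add_eq_zero, add_comm, h3]

end weights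

/-! ### Groups with an elementary abelian subgroup of index two -/

theorem sum_filter_pairing (g : F2Cube) : ∑ p with pairing p g = 1, p = 0 := by
  revert g; decide +kernel

theorem card_filter_pairing_le (g : F2Cube) : ({p | pairing p g = 1} : Finset F2Cube).card ≤ 4 := by
  revert g; decide +kernel

theorem pairing_add_ne_one {p q g : F2Cube} (hp : pairing p g = 1) (hq : pairing q g = 1) :
    pairing (p + q) g ≠ 1 := by
  rw [pairing_add_left, hp, hq]; decide

section index_two

variable (ρ : Representation K G (Fin n → K)) (κ : Multiplicative F2Cube →* G) (c : G)

theorem mem_invariants_of_index_two (hG : ∀ g, ∃ x, g = κ x ∨ g = κ x * c)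
    {f : MvPolynomial (Fin n) K} (hf : f ∈ invariants (ρ.comp κ)) (hc : linSubst (ρ c) f = f) :
    f ∈ invariants ρ := by
  have hκ : ∀ x, linSubst (ρ (κ x)) f = f := fun x => by simpa using hf x⁻¹
  intro g
  obtain ⟨x, hx | hx⟩ := hG g⁻¹
  · rw [hx, hκ]
  · rw [hx, map_mul, linSubst_mul, hκ, hc]

theorem linSubst_mem_invariantsLE (hconj : ∀ x, ∃ y, c * κ x = κ y * c)
    {d : ℕ} {f : MvPolynomial (Fin n) K} (hf : f ∈ invariantsLE (ρ.comp κ) d) :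
    linSubst (ρ c) f ∈ invariantsLE (ρ.comp κ) d := by
  refine ⟨fun x => ?_, (totalDegree_linSubst_le _ _).trans hf.2⟩
  obtain ⟨y, hy⟩ := hconj x⁻¹
  have hκ : linSubst (ρ (κ y)) f = f := by simpa using hf.1 y⁻¹
  rw [MonoidHom.comp_apply, ← linSubst_mul, ← map_mul, hy, map_mul, linSubst_mul, hκ]

theorem linSubst_linSubst (hsq : ∃ x, c * c = κ x)
    {f : MvPolynomial (Fin n) K} (hf : f ∈ invariants (ρ.comp κ)) :
    linSubst (ρ c) (linSubst (ρ c) f) = f := by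
  obtain ⟨x, hx⟩ := hsq
  have hκ : linSubst (ρ (κ x)) f = f := by simpa using hf x⁻¹
  rw [← linSubst_mul, ← map_mul, hx, hκ]

variable (hG : ∀ g, ∃ x, g = κ x ∨ g = κ x * c) (hconj : ∀ x, ∃ y, c * κ x = κ y * c)
  (hsq : ∃ x, c * c = κ x)

include hG hconj hsq

/-- The trace of an invariant of the subgroup is an invariant of the group. -/
theorem trace_mem_invariantsLE {d : ℕ} {f : MvPolynomial (Fin n) K}
    (hf : f ∈ invariantsLE (ρ.comp κ) d) : f + linSubst (ρ c) f ∈ invariantsLE ρ d := by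
  have := add_mem_invariantsLE hf (linSubst_mem_invariantsLE ρ κ c hconj hf)
  refine ⟨mem_invariants_of_index_two ρ κ c hG this.1 ?_, this.2⟩
  rw [map_add, linSubst_linSubst ρ κ c hsq hf.1, add_comm]

/-- The norm of an invariant of the subgroup is an invariant of the group. -/
theorem norm_mem_invariantsLE {d : ℕ} {f : MvPolynomial (Fin n) K}
    (hf : f ∈ invariantsLE (ρ.comp κ) d) : f * linSubst (ρ c) f ∈ invariantsLE ρ (d + d) := by
  have := mul_mem_invariantsLE hf (linSubst_mem_invariantsLE ρ κ c hconj hf)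
  refine ⟨mem_invariants_of_index_two ρ κ c hG this.1 ?_, this.2⟩
  rw [map_mul, linSubst_linSubst ρ κ c hsq hf.1, mul_comm]

/-- If the invariants of degree at most `2d` of the group agree at `v` and `w`, then those of degree
at most `d` of the subgroup agree either at `v` and `w` or at `v` and `c w`: for each `f` the values
`f(w)` and `f(c w)` are the roots of the quadratic with roots `f(v)` and `f(c v)`. -/
theorem agree_or_agree {v w : Fin n → K} {d : ℕ}
    (h : ∀ f ∈ invariantsLE ρ (d + d), eval v f = eval w f) :
    (∀ f ∈ invariantsLE (ρ.comp κ) d, eval v f = eval w f) ∨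
      (∀ f ∈ invariantsLE (ρ.comp κ) d, eval v f = eval (ρ c w) f) := by
  have key : ∀ f ∈ invariantsLE (ρ.comp κ) d, eval v f = eval w f ∨ eval v f = eval (ρ c w) f := by
    intro f hf
    have h1 := h _ (invariantsLE_mono ρ (Nat.le_add_left d d)
      (trace_mem_invariantsLE ρ κ c hG hconj hsq hf))
    have h2 := h _ (norm_mem_invariantsLE ρ κ c hG hconj hsq hf)
    simp only [map_add, map_mul, eval_linSubst] at h1 h2
    have : (eval v f - eval w f) * (eval v f - eval (ρ c w) f) = 0 := by
      linear_combination eval v f * h1 - h2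
    rcases mul_eq_zero.1 this with h | h
    · exact .inl (sub_eq_zero.1 h)
    · exact .inr (sub_eq_zero.1 h)
  -- A vector space is not the union of two proper subspaces.
  by_contra hcon
  push Not at hcon
  obtain ⟨⟨f, hf, hfn⟩, f', hf', hfn'⟩ := hcon
  have h1 := (key f hf).resolve_left hfn
  have h2 := (key f' hf').resolve_right hfn'
  rcases key _ (add_mem_invariantsLE hf hf') with h | h <;> rw [map_add, map_add] at h
  · exact hfn (by linear_combination h - h2)
  · exact hfn' (by linear_combination h - h1)

/-- Let the invariants of degree at most six of the group, and those of degree at most three of the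
subgroup, agree at `v` and `w`. If `w` is not in the orbit of `v` under the subgroup, then there is
an invariant `f` of the subgroup, a product of four weight forms, with `f(w) = -f(v) ≠ 0`. Comparing
the traces of `f k` for the invariants `k` of degree at most two shows that `k(v) = k(c v)` and
`f(c v) = -f(v)`; then `w` is in the orbit of `c v` under the subgroup. -/
theorem exists_apply_eq_of_agree (h2 : (2 : K) ≠ 0) {v w : Fin n → K}
    (h : ∀ f ∈ invariantsLE ρ 6, eval v f = eval w f)
    (hvw : ∀ f ∈ invariantsLE (ρ.comp κ) 3, eval v f = eval w f) : ∃ g, ρ g v = w := by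
  obtain ⟨e, he⟩ := exists_sgn_of_agree fun f hf => hvw f (invariantsLE_mono _ (by norm_num) hf)
  let S : F2Cube → Prop := fun p => ∃ l ∈ weightForms (ρ.comp κ) p, l v ≠ 0
  have hline : ∀ p q, S p → S q → S (p + q) → e (p + q) = e p + e q :=
    fun p q hp hq hpq => sgn_line_of_agree h2 hvw he hp hq hpq
  by_cases hcirc : ∀ g, (∀ p, p ≠ 0 → (S p ↔ pairing p g = 1)) → ∑ p with pairing p g = 1, e p = 0
  · obtain ⟨x, hx⟩ := exists_pairing_eq S e hline hcirc
    exact ⟨κ (.ofAdd x), apply_eq_of_sgn (τ := ρ.comp κ) h2 he hx⟩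
  push Not at hcirc
  obtain ⟨g, hSg, hsum⟩ := hcirc
  have hS : ∀ p, pairing p g = 1 → S p := fun p hp => by
    refine (hSg p ?_).2 hp
    rintro rfl
    rw [pairing_zero_left] at hp
    exact zero_ne_one hp
  have hl : ∀ p, ∃ l ∈ weightForms (ρ.comp κ) p, pairing p g = 1 → l v ≠ 0 := fun p => by
    by_cases hp : pairing p g = 1
    · obtain ⟨l, hl, hlv⟩ := hS p hp
      exact ⟨l, hl, fun _ => hlv⟩
    · exact ⟨0, fun x => by simp, fun h => absurd h hp⟩
  choose l hl hlv using hl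
  set T : Finset F2Cube := {p | pairing p g = 1} with hT
  set f : MvPolynomial (Fin n) K := ∏ p ∈ T, linForm (l p) with hf
  have hfmem : f ∈ invariantsLE (ρ.comp κ) 4 := invariantsLE_mono _ (card_filter_pairing_le g)
    (prod_linForm_mem T (fun p => p) l (fun p _ => hl p) (sum_filter_pairing g))
  have hfeval : ∀ u, eval u f = ∏ p ∈ T, l p u := fun u => by
    simp only [hf, map_prod, eval_linForm]
  have hfv : eval v f ≠ 0 := by
    rw [hfeval]
    exact Finset.prod_ne_zero_iff.2 fun p hp => hlv p (by simpa [hT] using hp)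
  have hfsgn : ∀ (e : F2Cube → ZMod 2) (u : Fin n → K),
      (∀ p, ∀ l ∈ weightForms (ρ.comp κ) p, l u = sgn K (e p) * l v) →
      eval u f = sgn K (∑ p ∈ T, e p) * eval v f := fun e u hu => by
    rw [hfeval, hfeval, sgn_sum, ← Finset.prod_mul_distrib]
    exact Finset.prod_congr rfl fun p _ => hu p _ (hl p)
  have hone : ∀ a : ZMod 2, a ≠ 0 → a = 1 := by decide
  have hfw : eval w f = -eval v f := by
    rw [hfsgn e w he, hone _ hsum, sgn_one, neg_one_mul]
  have hcw : ∀ k ∈ invariantsLE (ρ.comp κ) 2, eval (ρ c v) k = eval (ρ c w) k := fun k hk => by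
    rw [← eval_linSubst, ← eval_linSubst]
    exact hvw _ (invariantsLE_mono _ (by norm_num) (linSubst_mem_invariantsLE ρ κ c hconj hk))
  have htrace : ∀ k ∈ invariantsLE (ρ.comp κ) 2,
      2 * eval v f * eval v k = (eval (ρ c w) f - eval (ρ c v) f) * eval (ρ c v) k := by
    intro k hk
    have h1 := h _ (trace_mem_invariantsLE ρ κ c hG hconj hsq (mul_mem_invariantsLE hfmem hk))
    simp only [map_add, map_mul, eval_linSubst] at h1
    rw [hfw, ← hvw k (invariantsLE_mono _ (by norm_num) hk), ← hcw k hk] at h1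
    linear_combination h1
  -- The case `k = 1` shows that the coefficient on the right equals the one on the left.
  have htrace1 := htrace 1 (one_mem_invariantsLE _ _)
  rw [map_one, map_one, mul_one, mul_one] at htrace1
  have hcv : ∀ k ∈ invariantsLE (ρ.comp κ) 2, eval v k = eval (ρ c v) k := fun k hk => by
    have := htrace k hk
    rw [← htrace1] at this
    exact mul_left_cancel₀ (mul_ne_zero h2 hfv) this
  obtain ⟨e', he'⟩ := exists_sgn_of_agree hcv
  obtain ⟨e'', he''⟩ := exists_sgn_of_agree (τ := ρ.comp κ) (v := v) (w := ρ c w) fun k hk => by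
    rw [hcv k hk, hcw k hk]
  -- Both `f(c v)` and `f(c w)` are `±f(v)` and their difference is `2 f(v)`, so `f(c v) = -f(v)`.
  have hsum' : ∑ p ∈ T, e' p = 1 := by
    refine hone _ fun h0 => ?_
    have h1 := hfsgn e' _ he'
    rw [h0, sgn_zero, one_mul] at h1
    have h3 := hfsgn e'' _ he''
    rw [h1, h3] at htrace1
    set a := ∑ p ∈ T, e'' p
    have h4 : sgn K a = 3 := mul_right_cancel₀ hfv (by linear_combination -htrace1)
    have h8 : (2 : K) ^ 3 = 0 := by
      have := sgn_mul_self (K := K) a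
      rw [h4] at this
      linear_combination this
    exact h2 (pow_eq_zero_iff (by norm_num) |>.1 h8)
  -- Hence the signs relating `w` to `c v` respect also the relation with four terms.
  have hcomb : ∀ p, ∀ l ∈ weightForms (ρ.comp κ) p, l w = sgn K (e p + e' p) * l (ρ c v) := by
    intro p l hl
    rw [he p l hl, he' p l hl, sgn_add]
    linear_combination (-sgn K (e p) * l v) * sgn_mul_self (K := K) (e' p)
  have hline' : ∀ p q, S p → S q → S (p + q) → e' (p + q) = e' p + e' q := by
    have hzero : S 0 → e' 0 = 0 := by
      rintro ⟨l, hl, hlv⟩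
      have := hcv _ (invariantsLE_mono _ (by simp)
        (prod_linForm_mem Finset.univ ![0] ![l] (fun i _ => by fin_cases i; exact hl) (by simp)))
      simp only [Finset.univ_unique, Finset.prod_singleton, eval_linForm, Fin.default_eq_zero,
        Matrix.cons_val_zero] at this
      rw [he' 0 l hl] at this
      exact eq_zero_of_sgn_eq_one h2 (mul_right_cancel₀ hlv (by linear_combination -this))
    intro p q hp hq hpq
    -- The nonzero part of `S` is a plane complement, so `p`, `q`, `p + q` are not all nonzero.
    by_cases hp0 : p = 0
    · rw [hp0] at hp ⊢
      rw [hzero hp, zero_add, zero_add]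
    by_cases hq0 : q = 0
    · rw [hq0] at hq ⊢
      rw [hzero hq, add_zero, add_zero]
    by_cases hpq0 : p + q = 0
    · rw [hpq0] at hpq
      rw [hpq0, hzero hpq, CharTwo.add_eq_zero.1 hpq0, CharTwo.add_self_eq_zero]
    · exact absurd ((hSg _ hpq0).1 hpq)
        (pairing_add_ne_one ((hSg p hp0).1 hp) ((hSg q hq0).1 hq))
  obtain ⟨x, hx⟩ := exists_pairing_eq S (fun p => e p + e' p)
    (fun p q hp hq hpq => by
      rw [hline p q hp hq hpq, hline' p q hp hq hpq]; ring) (fun g' hg' => by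
      have hgg : ∀ p, pairing p g' = 1 ↔ pairing p g = 1 := fun p => by
        by_cases hp : p = 0
        · rw [hp, pairing_zero_left, pairing_zero_left]
        · rw [← hg' p hp, hSg p hp]
      simp only [hgg]
      rw [Finset.sum_add_distrib, hone _ hsum, hsum']
      decide)
  refine ⟨κ (.ofAdd x) * c, ?_⟩
  rw [map_mul]
  refine apply_eq_of_sgn (τ := ρ.comp κ) h2 hcomb fun p hp => ?_
  obtain ⟨l, hl, hlv⟩ := hp
  refine hx p ⟨l, hl, fun h0 => hlv ?_⟩
  rw [he' p l hl, h0, mul_zero]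

/-- For a group with a normal subgroup of index at most two that is an image of `C₂³`, and in characteristic
different from two, the invariants of degree at most six are separating. -/
theorem isSeparating_of_index_two (h2 : (2 : K) ≠ 0) : IsSeparating ρ (invariantsLE ρ 6) := by
  intro v w h
  rcases agree_or_agree ρ κ c hG hconj hsq (d := 3) h with hvw | hvw
  · exact exists_apply_eq_of_agree ρ κ c hG hconj hsq h2 h hvw
  · obtain ⟨g, hg⟩ := exists_apply_eq_of_agree ρ κ c hG hconj hsq h2
      (fun f hf => (h f hf).trans (eval_apply_of_mem_invariants hf.1 c w).symm) hvw
    refine ⟨c⁻¹ * g, ?_⟩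
    rw [map_mul, Module.End.mul_apply, hg, ← Module.End.mul_apply, ← map_mul, inv_mul_cancel,
      map_one, Module.End.one_apply]

end index_two

/-! ### The upper bound -/

/-- The subgroup `⟨a, b, c²⟩` of `(C₂ × C₂) ⋊ C₄`. -/
def cubeHom : Multiplicative F2Cube →* C2C2C4 where
  toFun x := ⟨(.ofAdd x.toAdd.1, .ofAdd x.toAdd.2.1), .ofAdd (2 * (x.toAdd.2.2.val : ZMod 4))⟩
  map_one' := rfl
  map_mul' := by
    have h : ∀ x y : F2Cube, (⟨(.ofAdd (x + y).1, .ofAdd (x + y).2.1),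
        .ofAdd (2 * ((x + y).2.2.val : ZMod 4))⟩ : C2C2C4) =
        ⟨(.ofAdd x.1, .ofAdd x.2.1), .ofAdd (2 * (x.2.2.val : ZMod 4))⟩ *
        ⟨(.ofAdd y.1, .ofAdd y.2.1), .ofAdd (2 * (y.2.2.val : ZMod 4))⟩ := by decide +kernel
    exact fun x y => h x.toAdd y.toAdd

theorem exists_eq_cubeHom (g : C2C2C4) : ∃ x, g = cubeHom x ∨ g = cubeHom x * gens 2 := by
  have h : ∀ (p q : ZMod 2) (r : ZMod 4), ∃ x : F2Cube,
      (⟨(.ofAdd p, .ofAdd q), .ofAdd r⟩ : C2C2C4) = cubeHom (.ofAdd x) ∨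
      (⟨(.ofAdd p, .ofAdd q), .ofAdd r⟩ : C2C2C4) = cubeHom (.ofAdd x) * gens 2 := by
    decide +kernel
  obtain ⟨x, hx⟩ := h g.left.1.toAdd g.left.2.toAdd g.right.toAdd
  exact ⟨.ofAdd x, hx⟩

theorem gens_two_mul_cubeHom (x : Multiplicative F2Cube) :
    ∃ y, gens 2 * cubeHom x = cubeHom y * gens 2 := by
  have h : ∀ x : F2Cube, gens 2 * cubeHom (.ofAdd x) =
      cubeHom (.ofAdd (x.2.1, x.1, x.2.2)) * gens 2 := by decide +kernel
  exact ⟨_, h x.toAdd⟩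

theorem gens_two_mul_self : ∃ x, gens 2 * gens 2 = cubeHom x :=
  ⟨.ofAdd (0, 0, 1), by decide +kernel⟩

theorem betaSepRep_le_six (h2 : (2 : K) ≠ 0) (ρ : Representation K C2C2C4 (Fin n → K)) :
    betaSepRep ρ ≤ 6 :=
  iInf₂_le 6 (isSeparating_of_index_two ρ cubeHom (gens 2) exists_eq_cubeHom gens_two_mul_cubeHom
    gens_two_mul_self h2)

/-! ### Monomial substitutions -/

/-- The monomial linear map `v ↦ (dᵢ v_{π i})ᵢ`. -/
def monomialMap (d : Fin n → K) (π : Equiv.Perm (Fin n)) : (Fin n → K) →ₗ[K] (Fin n → K) where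
  toFun v i := d i * v (π i)
  map_add' v w := by ext i; simp [mul_add]
  map_smul' a v := by ext i; simp [mul_left_comm]

theorem monomialMap_apply (d : Fin n → K) (π : Equiv.Perm (Fin n)) (v : Fin n → K) (i : Fin n) :
    monomialMap d π v i = d i * v (π i) := rfl

theorem linSubst_monomialMap_X (d : Fin n → K) (π : Equiv.Perm (Fin n)) (i : Fin n) :
    linSubst (monomialMap d π) (X i) = C (d i) * X (π i) := by
  rw [linSubst_X, Finset.sum_eq_single (π i)]
  · rw [LinearMap.toMatrix'_apply, monomialMap_apply, Pi.single_eq_same, mul_one]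
  · intro j _ hj
    rw [LinearMap.toMatrix'_apply, monomialMap_apply, Pi.single_eq_of_ne' hj, mul_zero, map_zero,
      zero_mul]
  · simp

theorem linSubst_monomialMap_monomial (d : Fin n → K) (π : Equiv.Perm (Fin n)) (m : Fin n →₀ ℕ)
    (a : K) : linSubst (monomialMap d π) (monomial m a) =
      monomial (m.mapDomain π) ((∏ i, d i ^ m i) * a) := by
  rw [monomial_eq, map_mul, ← algebraMap_eq, AlgHom.commutes, monomial_eq,
    Finsupp.prod_mapDomain_index_inj π.injective, Finsupp.prod_fintype _ _ (by simp),
    Finsupp.prod_fintype _ _ (by simp), map_prod]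
  simp only [map_pow, linSubst_monomialMap_X, mul_pow, Finset.prod_mul_distrib, algebraMap_eq,
    map_mul, map_prod]
  ring

theorem coeff_linSubst_monomialMap (d : Fin n → K) (π : Equiv.Perm (Fin n)) (m : Fin n →₀ ℕ)
    (f : MvPolynomial (Fin n) K) :
    coeff (m.mapDomain π) (linSubst (monomialMap d π) f) = (∏ i, d i ^ m i) * coeff m f := by
  induction f using MvPolynomial.induction_on' with
  | monomial u a =>
    rw [linSubst_monomialMap_monomial, coeff_monomial, coeff_monomial]
    by_cases h : u = m
    · rw [if_pos h, if_pos (by rw [h]), h]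
    · rw [if_neg h, if_neg fun h' => h (Finsupp.mapDomain_injective π.injective h'), mul_zero]
  | add p q hp hq => rw [map_add, coeff_add, hp, hq, coeff_add, mul_add]

/-! ### The lower bound -/

theorem sq_eq_neg_one_of_orderOf {i : K} (hi : orderOf i = 4) : i * i = -1 := by
  have h4 : i ^ 4 = 1 := hi ▸ pow_orderOf_eq_one i
  have h2 : i * i ≠ 1 := fun h => by
    have := orderOf_dvd_of_pow_eq_one (show i ^ 2 = 1 by rw [sq, h])
    rw [hi] at this
    exact absurd this (by decide)
  have : (i * i - 1) * (i * i + 1) = 0 := by linear_combination h4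
  rcases mul_eq_zero.1 this with h | h
  · exact absurd (sub_eq_zero.1 h) h2
  · linear_combination h

theorem two_ne_zero_of_orderOf {i : K} (hi : orderOf i = 4) : (2 : K) ≠ 0 := fun h2 => by
  have h1 := sq_eq_neg_one_of_orderOf hi
  have := orderOf_dvd_of_pow_eq_one (show i ^ 2 = 1 by linear_combination h1 - h2)
  rw [hi] at this
  exact absurd this (by decide)

/-- The images of `a`, `b`, `c` in the representation `W ⊕ χ ⊕ χ'` of dimension four: `W` is the
two dimensional representation that factors through the dihedral group of order eight, and `χ`, `χ'`
are the characters with `χ(c) = χ'(c) = i`, `χ(a) = χ(b) = 1`, `χ'(a) = χ'(b) = -1`. -/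
def genMap (i : K) : Fin 3 → Module.End K (Fin 4 → K) :=
  ![monomialMap ![1, -1, 1, -1] 1, monomialMap ![-1, 1, 1, -1] 1,
    monomialMap ![1, 1, i, i] (Equiv.swap 0 1)]

section lower

variable {i : K} (hi : i * i = -1)

theorem genMap_zero_sq (i : K) : genMap i 0 ^ 2 = 1 := by
  refine LinearMap.ext fun v => funext fun j => ?_
  fin_cases j <;> simp [genMap, sq, monomialMap_apply]

theorem genMap_one_sq (i : K) : genMap i 1 ^ 2 = 1 := by
  refine LinearMap.ext fun v => funext fun j => ?_
  fin_cases j <;> simp [genMap, sq, monomialMap_apply]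

include hi in
theorem genMap_two_sq : genMap i 2 ^ 2 = monomialMap ![1, 1, -1, -1] 1 := by
  refine LinearMap.ext fun v => funext fun j => ?_
  fin_cases j <;> simp [genMap, sq, monomialMap_apply, ← mul_assoc, hi, Equiv.swap_apply_of_ne_of_ne]

include hi in
theorem genMap_two_pow_four : genMap i 2 ^ 4 = 1 := by
  rw [pow_mul (genMap i 2) 2 2, genMap_two_sq hi]
  refine LinearMap.ext fun v => funext fun j => ?_
  fin_cases j <;> simp [sq, monomialMap_apply]

theorem genMap_zero_mul_one (i : K) : genMap i 0 * genMap i 1 = genMap i 1 * genMap i 0 := by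
  refine LinearMap.ext fun v => funext fun j => ?_
  fin_cases j <;> simp [genMap, monomialMap_apply]

theorem genMap_two_mul_zero (i : K) : genMap i 2 * genMap i 0 = genMap i 1 * genMap i 2 := by
  refine LinearMap.ext fun v => funext fun j => ?_
  fin_cases j <;> simp [genMap, monomialMap_apply, Equiv.swap_apply_of_ne_of_ne]

theorem genMap_two_mul_one (i : K) : genMap i 2 * genMap i 1 = genMap i 0 * genMap i 2 := by
  refine LinearMap.ext fun v => funext fun j => ?_
  fin_cases j <;> simp [genMap, monomialMap_apply, Equiv.swap_apply_of_ne_of_ne]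

/-- The linear maps `genMap i` as invertible maps. -/
def genUnit : Fin 3 → (Module.End K (Fin 4 → K))ˣ :=
  ![.ofPowEqOne _ 2 (genMap_zero_sq i) two_ne_zero, .ofPowEqOne _ 2 (genMap_one_sq i) two_ne_zero,
    .ofPowEqOne _ 4 (genMap_two_pow_four hi) four_ne_zero]

theorem coe_genUnit (j : Fin 3) : (genUnit hi j : Module.End K (Fin 4 → K)) = genMap i j := by
  fin_cases j <;> rfl

theorem lift_genUnit_eq_one : ∀ r ∈ presRels, FreeGroup.lift (genUnit hi) r = 1 := by
  intro r hr
  simp only [presRels, Set.mem_insert_iff, Set.mem_singleton_iff] at hr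
  rcases hr with rfl | rfl | rfl | rfl | rfl | rfl <;>
    simp only [map_mul, map_pow, map_inv, FreeGroup.lift_apply_of]
  · ext1; simpa [coe_genUnit] using genMap_zero_sq i
  · ext1; simpa [coe_genUnit] using genMap_one_sq i
  · ext1; simpa [coe_genUnit] using genMap_two_pow_four hi
  · rw [mul_inv_eq_one]; ext1; simpa [coe_genUnit] using genMap_zero_mul_one i
  · rw [mul_inv_eq_one, mul_inv_eq_iff_eq_mul]; ext1
    simpa [coe_genUnit] using genMap_two_mul_zero i
  · rw [mul_inv_eq_one, mul_inv_eq_iff_eq_mul]; ext1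
    simpa [coe_genUnit] using genMap_two_mul_one i

/-- The representation of `(C₂ × C₂) ⋊ C₄` in which `a`, `b`, `c` act by `genMap i`. -/
def fourDimRep : Representation K C2C2C4 (Fin 4 → K) :=
  (Units.coeHom _).comp ((PresentedGroup.toGroup (lift_genUnit_eq_one hi)).comp
    (MulEquiv.ofBijective _ bijective_toGroup).symm.toMonoidHom)

theorem fourDimRep_toGroup (x : PresentedGroup presRels) :
    fourDimRep hi (PresentedGroup.toGroup lift_gens_eq_one x) =
      PresentedGroup.toGroup (lift_genUnit_eq_one hi) x := by
  have : (MulEquiv.ofBijective _ bijective_toGroup).symm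
      (PresentedGroup.toGroup lift_gens_eq_one x) = x :=
    (MulEquiv.ofBijective _ bijective_toGroup).symm_apply_apply x
  simp only [fourDimRep, MonoidHom.comp_apply, Units.coeHom_apply]
  exact congrArg (fun y => ((PresentedGroup.toGroup (lift_genUnit_eq_one hi) y :
    (Module.End K (Fin 4 → K))ˣ) : Module.End K (Fin 4 → K))) this

theorem fourDimRep_gens (j : Fin 3) : fourDimRep hi (gens j) = genMap i j := by
  have := fourDimRep_toGroup hi (PresentedGroup.of j)
  rwa [PresentedGroup.toGroup.of, PresentedGroup.toGroup.of, coe_genUnit] at this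

theorem closure_range_gens : Subgroup.closure (Set.range gens) = ⊤ := by
  have h := congrArg (Subgroup.map (PresentedGroup.toGroup lift_gens_eq_one))
    (PresentedGroup.closure_range_of presRels)
  rw [MonoidHom.map_closure, ← Set.range_comp,
    Subgroup.map_top_of_surjective _ bijective_toGroup.2] at h
  rw [← h]
  congr 2
  ext j : 1
  exact (PresentedGroup.toGroup.of lift_gens_eq_one).symm

/-- In coordinates `(y, y', q, r)` of `K⁴`, the function `y y' q³ r` of degree six is
constant on the orbits of `fourDimRep`. -/
theorem fourDimRep_sextic (g : C2C2C4) (v : Fin 4 → K) :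
    fourDimRep hi g v 0 * fourDimRep hi g v 1 * fourDimRep hi g v 2 ^ 3 * fourDimRep hi g v 3 =
      v 0 * v 1 * v 2 ^ 3 * v 3 := by
  have hg : g ∈ Subgroup.closure (Set.range gens) := closure_range_gens ▸ Subgroup.mem_top g
  induction hg using Subgroup.closure_induction generalizing v with
  | mem x hx =>
    obtain ⟨j, rfl⟩ := hx
    have h4 : i ^ 4 = 1 := by linear_combination (i * i - 1) * hi
    rw [fourDimRep_gens]
    fin_cases j
    · simp [genMap, monomialMap_apply]
    · simp [genMap, monomialMap_apply]
    · simp [genMap, monomialMap_apply, Equiv.swap_apply_of_ne_of_ne]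
      linear_combination (v 0 * v 1 * v 2 ^ 3 * v 3) * h4
  | one => simp
  | mul x y _ _ hx hy => rw [map_mul, Module.End.mul_apply, hx, hy]
  | inv x _ hx =>
    rw [← hx, ← Module.End.mul_apply, ← map_mul, mul_inv_cancel, map_one, Module.End.one_apply]

theorem linSubst_genMap {f : MvPolynomial (Fin 4) K} (hf : f ∈ invariants (fourDimRep hi))
    (j : Fin 3) : linSubst (genMap i j) f = f := by
  have := hf (gens j)⁻¹
  rwa [inv_inv, fourDimRep_gens] at this

theorem prod_eq_one_of_linSubst_eq {d : Fin n → K} {f : MvPolynomial (Fin n) K}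
    (hf : linSubst (monomialMap d 1) f = f) {m : Fin n →₀ ℕ} (hm : coeff m f ≠ 0) :
    ∏ i, d i ^ m i = 1 := by
  have := coeff_linSubst_monomialMap d 1 m f
  rw [hf, Equiv.Perm.coe_one, Finsupp.mapDomain_id] at this
  exact mul_right_cancel₀ hm (by rw [← this, one_mul])

/-- The invariants of degree at most five take the same value at `(1, 1, 1, 1)` and
`(-1, 1, 1, 1)`. In a monomial of an invariant of `⟨a, b, c²⟩` the four exponents have the same
parity. The values can differ only through monomials with all exponents odd, and the only one of
degree at most five is the product of the coordinates, on which `c` acts by `-1`. -/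
theorem eval_eq_of_totalDegree_le_five (h2 : (2 : K) ≠ 0) {f : MvPolynomial (Fin 4) K}
    (hf : f ∈ invariantsLE (fourDimRep hi) 5) :
    eval ![1, 1, 1, 1] f = eval ![-1, 1, 1, 1] f := by
  have hodd : ∀ k : ℕ, (-1 : K) ^ k = 1 → Even k := fun k hk => by
    by_contra hne
    rw [Nat.not_even_iff_odd] at hne
    rw [hne.neg_one_pow] at hk
    exact h2 (by linear_combination -hk)
  have hA := linSubst_genMap hi hf.1 0
  have hB := linSubst_genMap hi hf.1 1
  have hC := linSubst_genMap hi hf.1 2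
  have hCC : linSubst (monomialMap ![1, 1, -1, -1] 1) f = f := by
    rw [← genMap_two_sq hi, sq, linSubst_mul, hC, hC]
  rw [eval_eq', eval_eq']
  refine Finset.sum_congr rfl fun m hm => ?_
  have hm0 := mem_support_iff.1 hm
  have ha := prod_eq_one_of_linSubst_eq hA hm0
  have hb := prod_eq_one_of_linSubst_eq hB hm0
  have hc := prod_eq_one_of_linSubst_eq hCC hm0
  simp only [Fin.prod_univ_four, Matrix.cons_val, one_pow, one_mul, mul_one, ← pow_add]
    at ha hb hc ⊢
  replace ha := hodd _ ha
  replace hb := hodd _ hb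
  replace hc := hodd _ hc
  have hdeg := (le_totalDegree hm).trans hf.2
  rw [Finsupp.sum_fintype _ _ (fun _ => rfl), Fin.sum_univ_four] at hdeg
  by_cases h0 : Even (m 0)
  · rw [h0.neg_one_pow, mul_one]
  exfalso
  have h1 : ∀ j, m j = 1 := by
    intro j
    have : m 0 = 1 ∧ m 1 = 1 ∧ m 2 = 1 ∧ m 3 = 1 := by grind
    obtain ⟨h0, h1, h2, h3⟩ := this
    fin_cases j <;> assumption
  have hmap : m.mapDomain (Equiv.swap (0 : Fin 4) 1) = m := by
    ext j
    rw [← Finsupp.equivMapDomain_eq_mapDomain, Finsupp.equivMapDomain_apply, h1, h1]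
  have := coeff_linSubst_monomialMap ![1, 1, i, i] (Equiv.swap 0 1) m f
  rw [show linSubst (monomialMap ![1, 1, i, i] (Equiv.swap 0 1)) f = f from hC, hmap] at this
  simp only [Fin.prod_univ_four, Matrix.cons_val, h1, pow_one, one_mul, hi] at this
  have h3 : 2 * coeff m f = 0 := by linear_combination this
  exact (mul_ne_zero h2 hm0) h3

theorem six_le_betaSepRep (h2 : (2 : K) ≠ 0) : 6 ≤ betaSepRep (fourDimRep hi) := by
  refine le_iInf₂ fun d hd => ?_
  by_contra hlt
  have hd5 : d ≤ 5 := by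
    have : d < 6 := by exact_mod_cast not_le.1 hlt
    omega
  obtain ⟨g, hg⟩ := hd ![1, 1, 1, 1] ![-1, 1, 1, 1] fun f hf =>
    eval_eq_of_totalDegree_le_five hi h2 (invariantsLE_mono _ hd5 hf)
  have := fourDimRep_sextic hi g ![1, 1, 1, 1]
  rw [hg] at this
  simp only [Matrix.cons_val, one_pow, mul_one] at this
  exact h2 (by linear_combination -this)

end lower

end SepNoether

end

theorem theorem4p3 {K : Type*} [Field K] (hK : ∃ i : K, orderOf i = 4) :
    SepNoether.betaSep K SepNoether.C2C2C4 = 6 := by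
  obtain ⟨i, hi⟩ := hK
  have h2 := SepNoether.two_ne_zero_of_orderOf hi
  refine le_antisymm (iSup₂_le fun n ρ => SepNoether.betaSepRep_le_six h2 ρ) ?_
  exact (SepNoether.six_le_betaSepRep (SepNoether.sq_eq_neg_one_of_orderOf hi) h2).trans
    (le_iSup₂ (f := fun (n : ℕ) (ρ : Representation K SepNoether.C2C2C4 (Fin n → K)) =>
      SepNoether.betaSepRep ρ) 4 _)
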